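/- Theorem 1 (Dimension shifts). For $d\ge 1$ let $|\cdot|$ be the Euclidean norm on $\mathbb{R}^d$, and for $z\in\mathbb{C}^d$ put $\|z\|:=\sup\{|\sum_{n=1}^d z_nt_n| : t\in\mathbb{R}^d,\ |t|\le 1\}$. An entire function $F:\mathbb{C}^d\to\mathbb{C}$, not identically zero, has exponential type at most $\delta$ if $\limsup_{\|z\|\to\infty}\|z\|^{-1}\log|F(z)|\le\delta$; it is real entire if it is real-valued on $\mathbb{R}^d$. A function $f:\mathbb{R}^d\to\mathbb{R}$ is eventually non-negative if $f(x)\ge 0$ for all sufficiently large $|x|$, and then $r(f):=\inf\{r>0 : f(x)\ge 0 \text{ for all } |x|\ge r\}$. Let $\mu$ be an even, locally finite, non-negative Borel measure on $\mathbb{R}$. Let $\mu^d$ be its radial lift to $\mathbb{R}^d$: on $\mathbb{R}^d\setminus\{0\}$ it is given in polar coordinates $x=r\omega$, $r>0$, $\omega\in\mathbb{S}^{d-1}$, by $d\mu^d(x)=d\sigma_{d-1}(\omega)\,d\mu(r)$, where $\sigma_{d-1}$ is the surface measure of the unit sphere $\mathbb{S}^{d-1}$, and $\mu^d(\{0\})=\tfrac12\sigma_{d-1}(\mathbb{S}^{d-1})\,\mu(\{0\})$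 (so $\mu^1=\mu$). For $\delta\ge 0$ let $$\mathbb{E}(\mu;\delta;d):=\inf_F\, r(F|_{\mathbb{R}^d})\in[0,\infty],$$ where the infimum (equal to $+\infty$ if there is no such $F$) is taken over all real entire functions $F:\mathbb{C}^d\to\mathbb{C}$, not identically zero, of exponential type at most $\delta$, such that $F\in L^1(\mathbb{R}^d,\mu^d)$, $\int_{\mathbb{R}^d}F\,d\mu^d\le 0$, and $F|_{\mathbb{R}^d}$ is eventually non-negative. Then, for every such $\mu$, every $\delta\ge 0$ and every integer $d\ge 1$, $$\mathbb{E}(\mu;\delta;d)=\mathbb{E}(\mu;\delta;1).$$ -/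

import Mathlib

open MeasureTheory Filter
open scoped ENNReal

noncomputable section

namespace SignUncertainty

/-- The inclusion `ℝ^d ⊆ ℂ^d`. -/
def toComplex {d : ℕ} (x : EuclideanSpace ℝ (Fin d)) : EuclideanSpace ℂ (Fin d) :=
  WithLp.toLp 2 fun i => (x i : ℂ)

/-- The norm `sup {|∑ₙ zₙ tₙ| : t ∈ ℝ^d, |t| ≤ 1}` on `ℂ^d`. -/
def supNorm {d : ℕ} (z : EuclideanSpace ℂ (Fin d)) : ℝ :=
  sSup ((fun t : EuclideanSpace ℝ (Fin d) => ‖∑ n, z n * (t n : ℂ)‖) '' {t | ‖t‖ ≤ 1})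

/-- The exponential type `limsup_{‖z‖ → ∞} ‖z‖⁻¹ log |F z|`, an extended real number
(with `log 0 = -∞`), with respect to the norm `supNorm`. -/
def expType {d : ℕ} (F : EuclideanSpace ℂ (Fin d) → ℂ) : EReal :=
  limsup (fun z => ENNReal.log ‖F z‖ₑ / (supNorm z : EReal)) (comap supNorm atTop)

/-- The restriction to `ℝ^d` of a function on `ℂ^d` that is real-valued on `ℝ^d`. -/
def realRestrict {d : ℕ} (F : EuclideanSpace ℂ (Fin d) → ℂ) (x : EuclideanSpace ℝ (Fin d)) : ℝ :=
  (F (toComplex x)).re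

/-- A function on `ℝ^d` is eventually non-negative if it is non-negative for all large `|x|`. -/
def EventuallyNonneg {d : ℕ} (f : EuclideanSpace ℝ (Fin d) → ℝ) : Prop :=
  ∃ r : ℝ, ∀ x, r ≤ ‖x‖ → 0 ≤ f x

/-- The radius of the last sign change, `inf {r > 0 : f x ≥ 0 for |x| ≥ r}`. -/
def lastSignChange {d : ℕ} (f : EuclideanSpace ℝ (Fin d) → ℝ) : ℝ≥0∞ :=
  sInf (ENNReal.ofReal '' {r : ℝ | 0 < r ∧ ∀ x, r ≤ ‖x‖ → 0 ≤ f x})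

/-- The standard surface measure on the unit sphere of `ℝ^d`. -/
def surfaceMeasure (d : ℕ) : Measure (Metric.sphere (0 : EuclideanSpace ℝ (Fin d)) 1) :=
  (volume : Measure (EuclideanSpace ℝ (Fin d))).toSphere

/-- The radial lift of an even measure `μ` on `ℝ` to `ℝ^d`. Away from the origin it is
`dσ(ω) dμ(r)` in polar coordinates `x = r ω`, `r > 0`. An atom of `μ` at `0`, which belongs in equal
parts to the two half-lines, is lifted to an atom at the origin of mass `σ(S^{d-1}) / 2 * μ {0}`.
For `d = 1` this is `μ` itself. -/
def radialLift (μ : Measure ℝ) (d : ℕ) : Measure (EuclideanSpace ℝ (Fin d)) :=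
  Measure.map (fun p : ℝ × Metric.sphere (0 : EuclideanSpace ℝ (Fin d)) 1 =>
      p.1 • (p.2 : EuclideanSpace ℝ (Fin d)))
    ((μ.restrict (Set.Ioi 0)).prod (surfaceMeasure d))
  + (surfaceMeasure d Set.univ / 2 * μ {0}) • Measure.dirac 0

/-- The nonzero members of the class of admissible functions on `ℂ^d`. -/
structure Admissible (μ : Measure ℝ) (δ : ℝ) (d : ℕ) (F : EuclideanSpace ℂ (Fin d) → ℂ) :
    Prop where
  ne_zero : F ≠ 0
  entire : Differentiable ℂ F
  real : ∀ x : EuclideanSpace ℝ (Fin d), (F (toComplex x)).im = 0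
  expType_le : expType F ≤ (δ : EReal)
  integrable : Integrable (realRestrict F) (radialLift μ d)
  integral_nonpos : ∫ x, realRestrict F x ∂(radialLift μ d) ≤ 0
  eventuallyNonneg : EventuallyNonneg (realRestrict F)

/-- The sign-uncertainty constant: the infimum in `[0, ∞]` of the radius of the last sign change
over all nonzero admissible functions (`∞` if there are none). -/
def signConstant (μ : Measure ℝ) (δ : ℝ) (d : ℕ) : ℝ≥0∞ :=
  sInf ((fun F => lastSignChange (realRestrict F)) '' {F | Admissible μ δ d F})

end SignUncertainty

end

/-!
Given `F` admissible on `ℂ^d`, let `g w` be the integral of `F (w ω)` over the unit sphere of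
`ℝ^d`. It is an even entire function of `w`, so `G z = g (√(z₁² + ⋯ + z_{d'}²))` is entire on
`ℂ^{d'}` for every dimension `d'`. Since `|z₁² + ⋯ + z_{d'}²| ≤ ‖z‖²`, the exponential type does
not increase, and averaging preserves non-negativity outside a ball. In polar coordinates the
radial lifts to different dimensions share the same measure on the half-line, so the integral of
`G` is a positive multiple of that of `F`. Finally `G ≠ 0`: otherwise `F`, non-negative on large
spheres with integral zero there, would vanish on all of them, hence identically.
-/

namespace SignUncertainty

section SupNorm

variable {d : ℕ}

/-- The real-linear map `t ↦ ∑ n, z n * t n`, whose operator norm is `supNorm z`. -/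
noncomputable def realPairing (z : EuclideanSpace ℂ (Fin d)) : EuclideanSpace ℝ (Fin d) →L[ℝ] ℂ :=
  ∑ n, (EuclideanSpace.proj n).smulRight (z n)

lemma realPairing_apply (z : EuclideanSpace ℂ (Fin d)) (t : EuclideanSpace ℝ (Fin d)) :
    realPairing z t = ∑ n, z n * (t n : ℂ) := by
  simp [realPairing, mul_comm]

lemma realPairing_smul (w : ℂ) (z : EuclideanSpace ℂ (Fin d)) :
    realPairing (w • z) = w • realPairing z := by
  ext t
  simp [realPairing_apply, Finset.mul_sum, mul_assoc]

lemma realPairing_toComplex (x : EuclideanSpace ℝ (Fin d)) :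
    realPairing (toComplex x) = Complex.ofRealLI.toContinuousLinearMap.comp (innerSL ℝ x) := by
  ext t
  simp [realPairing_apply, toComplex, PiLp.inner_apply, mul_comm]

lemma re_realPairing (z : EuclideanSpace ℂ (Fin d)) (t : EuclideanSpace ℝ (Fin d)) :
    (realPairing z t).re = inner ℝ (WithLp.toLp 2 fun n => (z n).re) t := by
  simp [realPairing_apply, PiLp.inner_apply, mul_comm]

lemma supNorm_eq_norm_realPairing (z : EuclideanSpace ℂ (Fin d)) :
    supNorm z = ‖realPairing z‖ := by
  rw [← ContinuousLinearMap.sSup_unitClosedBall_eq_norm, supNorm]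
  simp only [← realPairing_apply, Metric.closedBall, dist_zero_right]

lemma supNorm_nonneg (z : EuclideanSpace ℂ (Fin d)) : 0 ≤ supNorm z :=
  supNorm_eq_norm_realPairing z ▸ norm_nonneg _

lemma supNorm_smul (w : ℂ) (z : EuclideanSpace ℂ (Fin d)) :
    supNorm (w • z) = ‖w‖ * supNorm z := by
  simp only [supNorm_eq_norm_realPairing, realPairing_smul, norm_smul]

lemma supNorm_toComplex (x : EuclideanSpace ℝ (Fin d)) : supNorm (toComplex x) = ‖x‖ := by
  rw [supNorm_eq_norm_realPairing, realPairing_toComplex,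
    LinearIsometry.norm_toContinuousLinearMap_comp, innerSL_apply_norm]

lemma norm_re_le_supNorm (z : EuclideanSpace ℂ (Fin d)) :
    ‖(WithLp.toLp 2 fun n => (z n).re : EuclideanSpace ℝ (Fin d))‖ ≤ supNorm z := by
  rw [← innerSL_apply_norm (𝕜 := ℝ)]
  refine ContinuousLinearMap.opNorm_le_bound _ (supNorm_nonneg z) fun t => ?_
  rw [innerSL_apply_apply, ← re_realPairing, supNorm_eq_norm_realPairing]
  exact (Complex.abs_re_le_norm _).trans ((realPairing z).le_opNorm t)

lemma re_sum_sq_le_supNorm_sq (z : EuclideanSpace ℂ (Fin d)) :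
    (∑ n, z n ^ 2).re ≤ supNorm z ^ 2 :=
  calc (∑ n, z n ^ 2).re = ∑ n, ((z n).re ^ 2 - (z n).im ^ 2) := by
        simp [Complex.re_sum, sq]
    _ ≤ ∑ n, (z n).re ^ 2 := Finset.sum_le_sum fun n _ => sub_le_self _ (sq_nonneg _)
    _ = ‖(WithLp.toLp 2 fun n => (z n).re : EuclideanSpace ℝ (Fin d))‖ ^ 2 :=
        by rw [EuclideanSpace.real_norm_sq_eq]
    _ ≤ supNorm z ^ 2 := by gcongr; exact norm_re_le_supNorm z

lemma norm_sum_sq_le_supNorm_sq (z : EuclideanSpace ℂ (Fin d)) :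
    ‖∑ n, z n ^ 2‖ ≤ supNorm z ^ 2 := by
  -- Multiplying `z` by a suitable unit `u` makes the sum real and keeps `supNorm z`.
  obtain ⟨v, hv, hvz⟩ := RCLike.exists_norm_eq_mul_self (∑ n, z n ^ 2)
  obtain ⟨u, rfl⟩ := IsAlgClosed.exists_pow_nat_eq v two_pos
  have hu : ‖u‖ = 1 := by
    rwa [norm_pow, pow_eq_one_iff_of_nonneg (norm_nonneg u) two_ne_zero] at hv
  have hrot : ∑ n, (u • z) n ^ 2 = (‖∑ n, z n ^ 2‖ : ℂ) := by
    simp only [PiLp.smul_apply, smul_eq_mul, mul_pow, ← Finset.mul_sum]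
    exact hvz.symm
  have hle := re_sum_sq_le_supNorm_sq (u • z)
  rwa [hrot, Complex.ofReal_re, supNorm_smul, hu, one_mul] at hle

end SupNorm

section ExpType

variable {d : ℕ} {F : EuclideanSpace ℂ (Fin d) → ℂ} {δ : ℝ}

lemma log_enorm_le_coe_iff {E : Type*} [SeminormedAddGroup E] {x : E} {a : ℝ} :
    ENNReal.log ‖x‖ₑ ≤ (a : EReal) ↔ ‖x‖ ≤ Real.exp a := by
  rw [← EReal.log_exp (a : EReal), ENNReal.log_le_log_iff, EReal.exp_coe, ← ofReal_norm,
    ENNReal.ofReal_le_ofReal_iff (Real.exp_pos a).le]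

lemma log_enorm_div_le_coe_iff {E : Type*} [SeminormedAddGroup E] {x : E} {c s : ℝ} (hs : 0 < s) :
    ENNReal.log ‖x‖ₑ / (s : EReal) ≤ (c : EReal) ↔ ‖x‖ ≤ Real.exp (c * s) := by
  rw [EReal.div_le_iff_le_mul (by exact_mod_cast hs) (EReal.coe_ne_top _), ← EReal.coe_mul,
    log_enorm_le_coe_iff, mul_comm]

lemma exists_norm_le_exp_of_expType_lt {c : ℝ} (h : expType F < (c : EReal)) :
    ∃ R, ∀ z, R ≤ supNorm z → ‖F z‖ ≤ Real.exp (c * supNorm z) := by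
  obtain ⟨R, -, hR⟩ := ((atTop_basis' 1).comap supNorm).eventually_iff.1
    (eventually_lt_of_limsup_lt h)
  refine ⟨max R 1, fun z hz => ?_⟩
  have hpos : 0 < supNorm z := one_pos.trans_le (le_of_max_le_right hz)
  exact (log_enorm_div_le_coe_iff hpos).1 (hR (le_of_max_le_left hz)).le

lemma expType_le_of_forall_norm_le_exp
    (h : ∀ c, δ < c → ∃ C, ∀ z, ‖F z‖ ≤ C * Real.exp (c * supNorm z)) :
    expType F ≤ (δ : EReal) := by
  refine EReal.le_of_forall_lt_iff_le.1 fun c hc => ?_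
  obtain ⟨c', hδc', hc'c⟩ := exists_between (EReal.coe_lt_coe_iff.1 hc)
  obtain ⟨C, hC⟩ := h c' hδc'
  have habsorb : ∀ᶠ s : ℝ in atTop, C ≤ Real.exp ((c - c') * s) :=
    (Real.tendsto_exp_atTop.comp (tendsto_id.const_mul_atTop (sub_pos.2 hc'c))
      ).eventually_ge_atTop C
  refine limsup_le_of_le (h := ?_)
  filter_upwards [tendsto_comap.eventually habsorb,
    tendsto_comap.eventually (eventually_gt_atTop 0)] with z hz hpos
  rw [log_enorm_div_le_coe_iff hpos]
  calc ‖F z‖ ≤ C * Real.exp (c' * supNorm z) := hC z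
    _ ≤ Real.exp ((c - c') * supNorm z) * Real.exp (c' * supNorm z) := by gcongr
    _ = Real.exp (c * supNorm z) := by rw [← Real.exp_add]; ring_nf

end ExpType

section RadialExtension

variable {g : ℂ → ℂ}

lemma eq_of_even_of_sq_eq_sq {α R : Type*} [CommRing R] [NoZeroDivisors R] {f : R → α}
    (hf : Function.Even f) {a b : R} (h : a ^ 2 = b ^ 2) : f a = f b := by
  rcases sq_eq_sq_iff_eq_or_eq_neg.1 h with rfl | rfl
  · rfl
  · exact hf b

lemma comp_sqrt_eq_comp_I_mul_sqrt_neg {α : Type*} {g : ℂ → α} (heven : Function.Even g) (w : ℂ) :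
    g (w ^ (2⁻¹ : ℂ)) = g (Complex.I * (-w) ^ (2⁻¹ : ℂ)) :=
  eq_of_even_of_sq_eq_sq heven (by simp [mul_pow])

lemma differentiable_comp_sqrt {E : Type*} [NormedAddCommGroup E] [NormedSpace ℂ E]
    [CompleteSpace E] {g : ℂ → E} (hg : Differentiable ℂ g) (heven : Function.Even g) :
    Differentiable ℂ fun w => g (w ^ (2⁻¹ : ℂ)) := by
  -- Each of the two expressions for `g (√w)` is holomorphic off one real half-axis.
  have hpunctured (w : ℂ) (hw : w ≠ 0) : DifferentiableAt ℂ (fun w => g (w ^ (2⁻¹ : ℂ))) w := by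
    rcases Complex.mem_slitPlane_or_neg_mem_slitPlane hw with h | h
    · exact (hg _).comp w (differentiableAt_id.cpow_const h)
    · simp only [comp_sqrt_eq_comp_I_mul_sqrt_neg heven]
      exact (hg _).comp w ((differentiableAt_id.neg.cpow_const h).const_mul _)
  have hcont : ContinuousAt (fun w => g (w ^ (2⁻¹ : ℂ))) 0 :=
    (hg _).continuousAt.comp <|
      (Complex.continuousAt_cpow_zero_of_re_pos (by norm_num)).comp
        (f := fun w : ℂ => (w, (2⁻¹ : ℂ))) (by fun_prop)
  intro w
  rcases eq_or_ne w 0 with rfl | hw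
  · exact (Complex.analyticAt_of_differentiable_on_punctured_nhds_of_continuousAt
      (eventually_nhdsWithin_of_forall hpunctured) hcont).differentiableAt
  · exact hpunctured w hw

/-- The extension of an even function `g` on `ℂ` to a function on `ℂ^d` that is radial on `ℝ^d`,
namely `z ↦ g (√(z₁² + ⋯ + z_d²))`; as `g` is even, the branch of the square root is immaterial. -/
noncomputable def radialExtension (d : ℕ) (g : ℂ → ℂ) (z : EuclideanSpace ℂ (Fin d)) : ℂ :=
  g ((∑ n, z n ^ 2) ^ (2⁻¹ : ℂ))

variable {d : ℕ}

lemma differentiable_radialExtension (hg : Differentiable ℂ g) (heven : Function.Even g) :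
    Differentiable ℂ (radialExtension d g) :=
  (differentiable_comp_sqrt hg heven).comp (by fun_prop)

lemma radialExtension_toComplex (heven : Function.Even g) (x : EuclideanSpace ℝ (Fin d)) :
    radialExtension d g (toComplex x) = g (‖x‖ : ℂ) := by
  refine eq_of_even_of_sq_eq_sq heven ?_
  rw [← Complex.ofReal_pow, EuclideanSpace.real_norm_sq_eq]
  simp [toComplex]

lemma radialExtension_single [NeZero d] (heven : Function.Even g) (w : ℂ) :
    radialExtension d g (EuclideanSpace.single 0 w) = g w :=
  eq_of_even_of_sq_eq_sq heven (by simp [ite_pow])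

lemma radialExtension_ne_zero [NeZero d] (heven : Function.Even g) (hg : g ≠ 0) :
    radialExtension d g ≠ 0 := by
  obtain ⟨w, hw⟩ := Function.ne_iff.1 hg
  exact Function.ne_iff.2 ⟨EuclideanSpace.single 0 w, by rwa [radialExtension_single heven]⟩

lemma norm_sqrt_sum_sq_le_supNorm (z : EuclideanSpace ℂ (Fin d)) :
    ‖(∑ n, z n ^ 2) ^ (2⁻¹ : ℂ)‖ ≤ supNorm z := by
  rw [← sq_le_sq₀ (norm_nonneg _) (supNorm_nonneg z), ← norm_pow, Complex.cpow_ofNat_inv_pow]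
  exact norm_sum_sq_le_supNorm_sq z

lemma expType_radialExtension_le {δ : ℝ} (hδ : 0 ≤ δ)
    (hg : ∀ c, δ < c → ∃ C, ∀ w, ‖g w‖ ≤ C * Real.exp (c * ‖w‖)) :
    expType (radialExtension d g) ≤ (δ : EReal) := by
  refine expType_le_of_forall_norm_le_exp fun c hc => ?_
  obtain ⟨C, hC⟩ := hg c hc
  have hc0 : 0 ≤ c := hδ.trans hc.le
  have hC0 : 0 ≤ C := by simpa using (norm_nonneg _).trans (hC 0)
  refine ⟨C, fun z => (hC _).trans ?_⟩
  gcongr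
  exact norm_sqrt_sum_sq_le_supNorm z

end RadialExtension

section IdentityTheorem

lemma eq_zero_of_eventually_eq_zero_on_real {E : Type*} [NormedAddCommGroup E] [NormedSpace ℂ E]
    [CompleteSpace E] {f : ℂ → E} (hf : Differentiable ℂ f) (h : ∀ᶠ t : ℝ in atTop, f t = 0) :
    f = 0 := by
  obtain ⟨a, ha⟩ := eventually_atTop.1 h
  have htend : Tendsto ((↑) : ℝ → ℂ) (nhdsWithin a (Set.Ioi a)) (nhdsWithin (a : ℂ) {(a : ℂ)}ᶜ) :=
    Complex.continuous_ofReal.continuousWithinAt.tendsto_nhdsWithin fun t ht =>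
      Complex.ofReal_injective.ne (ne_of_gt ht)
  have hfreq : ∃ᶠ w in nhdsWithin (a : ℂ) {(a : ℂ)}ᶜ, f w = 0 :=
    htend.frequently (eventually_nhdsWithin_of_forall (s := Set.Ioi a)
      fun t ht => ha t (le_of_lt ht)).frequently
  exact AnalyticOnNhd.eq_of_frequently_eq (fun w _ => hf.analyticAt w)
    (fun _ _ => analyticAt_const) hfreq

@[fun_prop]
lemma continuous_toComplex {d : ℕ} : Continuous (toComplex (d := d)) := by
  unfold toComplex
  fun_prop

lemma toComplex_add {d : ℕ} (x y : EuclideanSpace ℝ (Fin d)) :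
    toComplex (x + y) = toComplex x + toComplex y := by
  ext n
  simp [toComplex]

lemma toComplex_smul {d : ℕ} (r : ℝ) (x : EuclideanSpace ℝ (Fin d)) :
    toComplex (r • x) = (r : ℂ) • toComplex x := by
  ext n
  simp [toComplex]

lemma exists_eq_toComplex_add_I_smul_toComplex {d : ℕ} (z : EuclideanSpace ℂ (Fin d)) :
    ∃ x y, z = toComplex x + Complex.I • toComplex y := by
  refine ⟨WithLp.toLp 2 fun n => (z n).re, WithLp.toLp 2 fun n => (z n).im, ?_⟩
  ext n
  simp [toComplex, mul_comm Complex.I, Complex.re_add_im]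

variable {d : ℕ} {F : EuclideanSpace ℂ (Fin d) → ℂ}

lemma eq_zero_on_complex_line (hF : Differentiable ℂ F) {x y : EuclideanSpace ℝ (Fin d)}
    (h : ∀ᶠ t : ℝ in atTop, F (toComplex (x + t • y)) = 0) (w : ℂ) :
    F (toComplex x + w • toComplex y) = 0 := by
  have hline : Differentiable ℂ fun w : ℂ => F (toComplex x + w • toComplex y) :=
    hF.comp ((differentiable_id.smul_const _).const_add _)
  simp only [toComplex_add, toComplex_smul] at h
  exact congrFun (eq_zero_of_eventually_eq_zero_on_real hline h) w

lemma eq_zero_of_eq_zero_on_real (hF : Differentiable ℂ F) (h : ∀ x, F (toComplex x) = 0) :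
    F = 0 := by
  funext z
  obtain ⟨x, y, rfl⟩ := exists_eq_toComplex_add_I_smul_toComplex z
  exact eq_zero_on_complex_line hF (.of_forall fun _ => h _) Complex.I

lemma tendsto_norm_add_smul_atTop {E : Type*} [NormedAddCommGroup E] [NormedSpace ℝ E] (x : E)
    {y : E} (hy : y ≠ 0) : Tendsto (fun t : ℝ => ‖x + t • y‖) atTop atTop := by
  have hlower : Tendsto (fun t : ℝ => t * ‖y‖ - ‖x‖) atTop atTop :=
    tendsto_atTop_add_const_right _ _ (tendsto_id.atTop_mul_const (norm_pos_iff.2 hy))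
  refine tendsto_atTop_mono (fun t => ?_) hlower
  calc t * ‖y‖ - ‖x‖ ≤ ‖t • y‖ - ‖x‖ := by
        rw [norm_smul]
        gcongr
        exact Real.le_norm_self t
    _ ≤ ‖x + t • y‖ := by
        rw [add_comm]
        exact norm_sub_le_norm_add _ _

lemma eq_zero_of_eq_zero_on_large_real [NeZero d] (hF : Differentiable ℂ F) {R : ℝ}
    (h : ∀ x : EuclideanSpace ℝ (Fin d), R ≤ ‖x‖ → F (toComplex x) = 0) : F = 0 := by
  refine eq_zero_of_eq_zero_on_real hF fun x => ?_
  obtain ⟨y, hy⟩ := exists_ne (0 : EuclideanSpace ℝ (Fin d))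
  have hzero := eq_zero_on_complex_line hF (x := x) (y := y)
    (((tendsto_norm_add_smul_atTop x hy).eventually_ge_atTop R).mono fun _ => h _) 0
  rwa [zero_smul, add_zero] at hzero

end IdentityTheorem

section SphereIntegral

instance isFiniteMeasure_surfaceMeasure (d : ℕ) : IsFiniteMeasure (surfaceMeasure d) :=
  inferInstanceAs (IsFiniteMeasure (volume : Measure (EuclideanSpace ℝ (Fin d))).toSphere)

instance isOpenPosMeasure_surfaceMeasure (d : ℕ) : (surfaceMeasure d).IsOpenPosMeasure :=
  inferInstanceAs (volume : Measure (EuclideanSpace ℝ (Fin d))).toSphere.IsOpenPosMeasure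

lemma measurePreserving_neg_toSphere {E : Type*} [NormedAddCommGroup E] [NormedSpace ℝ E]
    [MeasurableSpace E] [BorelSpace E] (ν : Measure E) [ν.IsNegInvariant] :
    MeasurePreserving Neg.neg ν.toSphere ν.toSphere := by
  have hneg : Measurable (Neg.neg : Metric.sphere (0 : E) 1 → _) := continuous_neg.measurable
  refine ⟨hneg, Measure.ext fun s hs => ?_⟩
  have himage : ((↑) '' (Neg.neg ⁻¹' s) : Set E) = -((↑) '' s) := by
    rw [Set.neg_preimage, ← Set.image_neg_eq_neg, ← Set.image_neg_eq_neg, Set.image_image,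
      Set.image_image]
    rfl
  rw [Measure.map_apply hneg hs, Measure.toSphere_apply' _ hs, Measure.toSphere_apply' _ (hneg hs),
    himage, Set.smul_neg, Measure.measure_neg]

lemma exists_eq_norm_smul_sphere {E : Type*} [NormedAddCommGroup E] [NormedSpace ℝ E] {x : E}
    (hx : x ≠ 0) : ∃ ω : Metric.sphere (0 : E) 1, x = ‖x‖ • (ω : E) :=
  ⟨⟨‖x‖⁻¹ • x, by simp [norm_smul, hx]⟩, by simp [hx]⟩

lemma norm_smul_sphere {E : Type*} [NormedAddCommGroup E] [NormedSpace ℝ E] (r : ℝ)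
    (ω : Metric.sphere (0 : E) 1) : ‖r • (ω : E)‖ = |r| := by
  simp [norm_smul]

lemma differentiable_integral_of_compactSpace {X E : Type*} [TopologicalSpace X] [CompactSpace X]
    [SecondCountableTopology X] [MeasurableSpace X] [OpensMeasurableSpace X] [NormedAddCommGroup E]
    [NormedSpace ℂ E] [CompleteSpace E] {ν : Measure X} [IsFiniteMeasure ν]
    {f : X → ℂ → E} (hf : Continuous (Function.uncurry f)) (hfd : ∀ x, Differentiable ℂ (f x)) :
    Differentiable ℂ fun w => ∫ x, f x w ∂ν := by
  intro w₀
  obtain ⟨C, hC⟩ := (isCompact_univ (X := X)).prod (isCompact_closedBall w₀ 2)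
    |>.exists_bound_of_continuousOn hf.continuousOn
  have hcont (w : ℂ) : Continuous fun x => f x w := hf.comp (Continuous.prodMk_left w)
  have hderiv (x : X) (w : ℂ) (hw : w ∈ Metric.ball w₀ 1) : ‖deriv (f x) w‖ ≤ C / 1 := by
    refine Complex.norm_deriv_le_of_forall_mem_sphere_norm_le one_pos (hfd x).diffContOnCl
      fun v hv => hC (x, v) ⟨trivial, ?_⟩
    rw [Metric.mem_ball] at hw
    rw [Metric.mem_sphere] at hv
    rw [Metric.mem_closedBall]
    linarith [dist_triangle v w w₀]
  exact (hasDerivAt_integral_of_dominated_loc_of_deriv_le (bound := fun _ => C / 1)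
    (F := fun w x => f x w) (F' := fun w x => deriv (f x) w)
    (Metric.ball_mem_nhds w₀ one_pos)
    (.of_forall fun w => (hcont w).aestronglyMeasurable)
    ((hcont w₀).integrable_of_hasCompactSupport (.of_compactSpace _))
    ((stronglyMeasurable_deriv_with_param hf).comp_measurable
      measurable_prodMk_right).aestronglyMeasurable
    (.of_forall hderiv) (integrable_const _)
    (.of_forall fun x w _ => (hfd x w).hasDerivAt)).2.differentiableAt

variable {d : ℕ} {F : EuclideanSpace ℂ (Fin d) → ℂ}

/-- The integral of `F` over the unit sphere of `ℝ^d` dilated by a complex number `w`. It is not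
normalised by the area of the sphere. -/
noncomputable def sphericalIntegral (F : EuclideanSpace ℂ (Fin d) → ℂ) (w : ℂ) : ℂ :=
  ∫ ω, F (w • toComplex (ω : EuclideanSpace ℝ (Fin d))) ∂(surfaceMeasure d)

lemma even_sphericalIntegral (F : EuclideanSpace ℂ (Fin d) → ℂ) :
    Function.Even (sphericalIntegral F) := by
  intro w
  have hneg (x : EuclideanSpace ℝ (Fin d)) : toComplex (-x) = -toComplex x := by
    simpa using toComplex_smul (-1) x
  have hpres : MeasurePreserving (MeasurableEquiv.neg _) (surfaceMeasure d) (surfaceMeasure d) :=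
    measurePreserving_neg_toSphere volume
  rw [sphericalIntegral, sphericalIntegral, ← hpres.integral_comp']
  simp [hneg]

lemma differentiable_sphericalIntegral (hF : Differentiable ℂ F) :
    Differentiable ℂ (sphericalIntegral F) := by
  have hFc := hF.continuous
  exact differentiable_integral_of_compactSpace (by simp only [Function.uncurry_def]; fun_prop)
    fun ω => hF.comp (differentiable_id.smul_const _)

lemma integrable_sphere_of_continuous (hF : Continuous F) (w : ℂ) :
    Integrable (fun ω : Metric.sphere (0 : EuclideanSpace ℝ (Fin d)) 1 =>
      F (w • toComplex (ω : EuclideanSpace ℝ (Fin d)))) (surfaceMeasure d) :=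
  Continuous.integrable_of_hasCompactSupport (by fun_prop) (.of_compactSpace _)

lemma re_sphericalIntegral (hF : Continuous F) (r : ℝ) :
    (sphericalIntegral F r).re =
      ∫ ω, realRestrict F (r • (ω : EuclideanSpace ℝ (Fin d))) ∂(surfaceMeasure d) := by
  simp only [realRestrict, toComplex_smul]
  exact (integral_re (integrable_sphere_of_continuous hF r)).symm

lemma im_sphericalIntegral (hF : Continuous F) (hreal : ∀ x, (F (toComplex x)).im = 0) (r : ℝ) :
    (sphericalIntegral F r).im = 0 := by
  refine (integral_im (integrable_sphere_of_continuous hF r)).symm.trans ?_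
  simp only [← toComplex_smul, RCLike.im_to_complex, hreal, integral_zero]

lemma norm_sphericalIntegral_le {w : ℂ} {C : ℝ} (h : ∀ z, supNorm z = ‖w‖ → ‖F z‖ ≤ C) :
    ‖sphericalIntegral F w‖ ≤ C * (surfaceMeasure d).real Set.univ := by
  refine norm_integral_le_of_norm_le_const (.of_forall fun ω => h _ ?_)
  rw [supNorm_smul, supNorm_toComplex, norm_eq_of_mem_sphere, mul_one]

lemma exists_norm_sphericalIntegral_le_exp (hF : Differentiable ℂ F) {c : ℝ} (hc : 0 ≤ c)
    (hFc : expType F < (c : EReal)) :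
    ∃ C, ∀ w, ‖sphericalIntegral F w‖ ≤ C * Real.exp (c * ‖w‖) := by
  obtain ⟨R, hR⟩ := exists_norm_le_exp_of_expType_lt hFc
  obtain ⟨M, hM⟩ := (isCompact_closedBall (0 : ℂ) R).exists_bound_of_continuousOn
    (differentiable_sphericalIntegral hF).continuous.continuousOn
  refine ⟨max M ((surfaceMeasure d).real Set.univ), fun w => ?_⟩
  rcases le_total R ‖w‖ with hw | hw
  · calc ‖sphericalIntegral F w‖
        ≤ Real.exp (c * ‖w‖) * (surfaceMeasure d).real Set.univ :=
          norm_sphericalIntegral_le fun z hz => hz ▸ hR z (hz ▸ hw)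
      _ ≤ max M ((surfaceMeasure d).real Set.univ) * Real.exp (c * ‖w‖) := by
          rw [mul_comm]
          gcongr
          exact le_max_right _ _
  · calc ‖sphericalIntegral F w‖ ≤ M := hM w (mem_closedBall_zero_iff.2 hw)
      _ ≤ max M ((surfaceMeasure d).real Set.univ) := le_max_left _ _
      _ ≤ max M ((surfaceMeasure d).real Set.univ) * Real.exp (c * ‖w‖) :=
          le_mul_of_one_le_right (measureReal_nonneg.trans (le_max_right _ _))
            (Real.one_le_exp (by positivity))

lemma eq_zero_of_integral_sphere_eq_zero {h : EuclideanSpace ℝ (Fin d) → ℝ} (hc : Continuous h)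
    {x : EuclideanSpace ℝ (Fin d)} (hx : x ≠ 0) (hnn : ∀ y, ‖y‖ = ‖x‖ → 0 ≤ h y)
    (hint : ∫ ω, h (‖x‖ • (ω : EuclideanSpace ℝ (Fin d))) ∂(surfaceMeasure d) = 0) :
    h x = 0 := by
  have hcont : Continuous fun ω : Metric.sphere (0 : EuclideanSpace ℝ (Fin d)) 1 =>
      h (‖x‖ • (ω : EuclideanSpace ℝ (Fin d))) := by fun_prop
  rw [integral_eq_zero_iff_of_nonneg (fun ω => hnn _ (by simp [norm_smul_sphere]))
    (hcont.integrable_of_hasCompactSupport (.of_compactSpace _)),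
    Continuous.ae_eq_iff_eq _ hcont continuous_zero] at hint
  obtain ⟨ω, hω⟩ := exists_eq_norm_smul_sphere hx
  rw [hω]
  exact congrFun hint ω

lemma continuous_realRestrict (hF : Continuous F) : Continuous (realRestrict F) :=
  Complex.continuous_re.comp (hF.comp continuous_toComplex)

lemma sphericalIntegral_ne_zero [NeZero d] (hF : Differentiable ℂ F) (hF0 : F ≠ 0)
    (hreal : ∀ x, (F (toComplex x)).im = 0) (hnn : EventuallyNonneg (realRestrict F)) :
    sphericalIntegral F ≠ 0 := by
  intro hzero
  obtain ⟨R, hR⟩ := hnn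
  refine hF0 (eq_zero_of_eq_zero_on_large_real hF (R := max R 1) fun x hx => ?_)
  have hx0 : x ≠ 0 := norm_pos_iff.1 (one_pos.trans_le (le_of_max_le_right hx))
  have hint := re_sphericalIntegral hF.continuous ‖x‖
  rw [hzero, Pi.zero_apply, Complex.zero_re] at hint
  have hre : realRestrict F x = 0 :=
    eq_zero_of_integral_sphere_eq_zero (continuous_realRestrict hF.continuous) hx0
      (fun y hy => hR y (hy ▸ le_of_max_le_left hx)) hint.symm
  exact Complex.ext hre (hreal x)

end SphereIntegral

section RadialLift

/-- The factor `ν` on `[0, ∞)` in the decomposition of `radialLift μ d` as the image of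
`ν × surfaceMeasure d` under `(r, ω) ↦ r • ω`. The atom of `μ` at `0` is halved because the two
half-lines share it. -/
noncomputable def halfLineMeasure (μ : Measure ℝ) : Measure ℝ :=
  μ.restrict (Set.Ioi 0) + (μ {0} / 2) • Measure.dirac 0

lemma ae_halfLineMeasure_nonneg (μ : Measure ℝ) : ∀ᵐ r ∂(halfLineMeasure μ), 0 ≤ r := by
  refine ae_add_measure_iff.2 ⟨?_, Measure.ae_smul_measure ?_ _⟩
  · exact (ae_restrict_mem measurableSet_Ioi).mono fun r hr => le_of_lt hr
  · exact (ae_dirac_iff measurableSet_Ici).2 le_rfl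

variable {μ : Measure ℝ} [SFinite μ] {d : ℕ}

instance sFinite_halfLineMeasure : SFinite (halfLineMeasure μ) := by
  unfold halfLineMeasure
  infer_instance

lemma measurable_polar : Measurable
    (fun p : ℝ × Metric.sphere (0 : EuclideanSpace ℝ (Fin d)) 1 =>
      p.1 • (p.2 : EuclideanSpace ℝ (Fin d))) :=
  Continuous.measurable (by fun_prop)

lemma radialLift_eq_map_halfLineMeasure_prod :
    radialLift μ d = ((halfLineMeasure μ).prod (surfaceMeasure d)).map
      fun p => p.1 • (p.2 : EuclideanSpace ℝ (Fin d)) := by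
  have hatom : ((Measure.dirac (0 : ℝ)).prod (surfaceMeasure d)).map
      (fun p => p.1 • (p.2 : EuclideanSpace ℝ (Fin d))) =
        surfaceMeasure d Set.univ • Measure.dirac 0 := by
    rw [Measure.dirac_prod, Measure.map_map measurable_polar measurable_prodMk_left]
    simp [Function.comp_def]
  rw [halfLineMeasure, Measure.add_prod, Measure.map_add _ _ measurable_polar,
    Measure.prod_smul_left, Measure.map_smul, hatom, radialLift, smul_smul]
  congr 2
  simp only [div_eq_mul_inv]
  ring

lemma map_norm_radialLift :
    (radialLift μ d).map norm = surfaceMeasure d Set.univ • halfLineMeasure μ := by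
  rw [radialLift_eq_map_halfLineMeasure_prod, Measure.map_map measurable_norm measurable_polar,
    ← Measure.map_fst_prod]
  refine Measure.map_congr ?_
  filter_upwards [Measure.quasiMeasurePreserving_fst.ae (ae_halfLineMeasure_nonneg μ)] with p hp
  simp [norm_smul_sphere, abs_of_nonneg hp]

variable {E : Type*} [NormedAddCommGroup E]

lemma integrable_polar {h : EuclideanSpace ℝ (Fin d) → E} (hh : Integrable h (radialLift μ d)) :
    Integrable (fun p : ℝ × Metric.sphere (0 : EuclideanSpace ℝ (Fin d)) 1 =>
      h (p.1 • (p.2 : EuclideanSpace ℝ (Fin d))))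
      ((halfLineMeasure μ).prod (surfaceMeasure d)) := by
  rw [radialLift_eq_map_halfLineMeasure_prod] at hh
  exact hh.comp_measurable measurable_polar

lemma integrable_comp_norm_radialLift {φ : ℝ → E} (hφ : Integrable φ (halfLineMeasure μ)) :
    Integrable (fun x => φ ‖x‖) (radialLift μ d) := by
  refine Integrable.comp_measurable ?_ measurable_norm
  rw [map_norm_radialLift]
  exact hφ.smul_measure (measure_ne_top _ _)

variable [NormedSpace ℝ E]

lemma integral_radialLift {h : EuclideanSpace ℝ (Fin d) → E}
    (hh : Integrable h (radialLift μ d)) :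
    ∫ x, h x ∂(radialLift μ d) =
      ∫ r, ∫ ω, h (r • (ω : EuclideanSpace ℝ (Fin d)))
        ∂(surfaceMeasure d) ∂(halfLineMeasure μ) := by
  rw [← integral_prod _ (integrable_polar hh)]
  rw [radialLift_eq_map_halfLineMeasure_prod] at hh ⊢
  exact integral_map measurable_polar.aemeasurable hh.aestronglyMeasurable

lemma integral_comp_norm_radialLift {φ : ℝ → E}
    (hφ : AEStronglyMeasurable φ (halfLineMeasure μ)) :
    ∫ x, φ ‖x‖ ∂(radialLift μ d) =
      (surfaceMeasure d).real Set.univ • ∫ r, φ r ∂(halfLineMeasure μ) := by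
  rw [Measure.real, ← integral_smul_measure, ← map_norm_radialLift,
    integral_map measurable_norm.aemeasurable]
  rw [map_norm_radialLift]
  exact hφ.smul_measure _

end RadialLift

section Radialization

variable {d d' : ℕ} {F : EuclideanSpace ℂ (Fin d) → ℂ} {μ : Measure ℝ} {δ : ℝ}

/-- The entire function on `ℂ^d'` whose value at a real point `x` is the integral of `F` over the
sphere of radius `‖x‖` in `ℝ^d`, with respect to the surface measure of the unit sphere. -/
noncomputable def radialization (d' : ℕ) (F : EuclideanSpace ℂ (Fin d) → ℂ) :
    EuclideanSpace ℂ (Fin d') → ℂ :=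
  radialExtension d' (sphericalIntegral F)

lemma radialization_toComplex (F : EuclideanSpace ℂ (Fin d) → ℂ) (x : EuclideanSpace ℝ (Fin d')) :
    radialization d' F (toComplex x) = sphericalIntegral F (‖x‖ : ℂ) :=
  radialExtension_toComplex (even_sphericalIntegral F) x

lemma realRestrict_radialization (hF : Continuous F) (x : EuclideanSpace ℝ (Fin d')) :
    realRestrict (radialization d' F) x =
      ∫ ω, realRestrict F (‖x‖ • (ω : EuclideanSpace ℝ (Fin d))) ∂(surfaceMeasure d) := by
  rw [realRestrict, radialization_toComplex, re_sphericalIntegral hF]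

lemma realRestrict_radialization_nonneg (hF : Continuous F) {r : ℝ}
    (h : ∀ x, r ≤ ‖x‖ → 0 ≤ realRestrict F x) (x : EuclideanSpace ℝ (Fin d')) (hx : r ≤ ‖x‖) :
    0 ≤ realRestrict (radialization d' F) x := by
  rw [realRestrict_radialization hF]
  exact integral_nonneg fun ω => h _ (by simpa [norm_smul_sphere] using hx)

lemma integrable_realRestrict_radialization [SFinite μ] (hF : Continuous F)
    (hi : Integrable (realRestrict F) (radialLift μ d)) :
    Integrable (realRestrict (radialization d' F)) (radialLift μ d') := by
  rw [funext (realRestrict_radialization hF)]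
  exact integrable_comp_norm_radialLift (integrable_polar hi).integral_prod_left

lemma integral_realRestrict_radialization [SFinite μ] (hF : Continuous F)
    (hi : Integrable (realRestrict F) (radialLift μ d)) :
    ∫ x, realRestrict (radialization d' F) x ∂(radialLift μ d') =
      (surfaceMeasure d').real Set.univ * ∫ x, realRestrict F x ∂(radialLift μ d) := by
  simp only [realRestrict_radialization hF]
  rw [integral_comp_norm_radialLift (integrable_polar hi).integral_prod_left.aestronglyMeasurable,
    ← integral_radialLift hi, smul_eq_mul]

lemma expType_radialization_le (hδ : 0 ≤ δ) (hF : Differentiable ℂ F)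
    (hFδ : expType F ≤ (δ : EReal)) : expType (radialization d' F) ≤ (δ : EReal) :=
  expType_radialExtension_le hδ fun _ hc => exists_norm_sphericalIntegral_le_exp hF
    (hδ.trans hc.le) (hFδ.trans_lt (EReal.coe_lt_coe_iff.2 hc))

lemma Admissible.radialization [SFinite μ] [NeZero d] [NeZero d'] (hδ : 0 ≤ δ)
    (hF : Admissible μ δ d F) : Admissible μ δ d' (radialization d' F) where
  ne_zero := radialExtension_ne_zero (even_sphericalIntegral F)
    (sphericalIntegral_ne_zero hF.entire hF.ne_zero hF.real hF.eventuallyNonneg)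
  entire := differentiable_radialExtension (differentiable_sphericalIntegral hF.entire)
    (even_sphericalIntegral F)
  real x := by
    rw [radialization_toComplex, im_sphericalIntegral hF.entire.continuous hF.real]
  expType_le := expType_radialization_le hδ hF.entire hF.expType_le
  integrable := integrable_realRestrict_radialization hF.entire.continuous hF.integrable
  integral_nonpos := by
    rw [integral_realRestrict_radialization hF.entire.continuous hF.integrable]
    exact mul_nonpos_of_nonneg_of_nonpos measureReal_nonneg hF.integral_nonpos
  eventuallyNonneg := hF.eventuallyNonneg.imp fun _ =>
    realRestrict_radialization_nonneg hF.entire.continuous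

lemma lastSignChange_radialization_le (hF : Continuous F) :
    lastSignChange (realRestrict (radialization d' F)) ≤
      lastSignChange (realRestrict F) :=
  sInf_le_sInf <| Set.image_mono fun _ hr => ⟨hr.1, realRestrict_radialization_nonneg hF hr.2⟩

lemma signConstant_le_signConstant [SFinite μ] [NeZero d] [NeZero d'] (hδ : 0 ≤ δ) :
    signConstant μ δ d' ≤ signConstant μ δ d := by
  refine le_sInf ?_
  rintro _ ⟨F, hF, rfl⟩
  calc signConstant μ δ d' ≤ lastSignChange (realRestrict (radialization d' F)) :=
        sInf_le ⟨_, hF.radialization hδ, rfl⟩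
    _ ≤ lastSignChange (realRestrict F) := lastSignChange_radialization_le hF.entire.continuous

end Radialization

end SignUncertainty

theorem theorem1_general (μ : MeasureTheory.Measure ℝ) [MeasureTheory.SFinite μ] (δ : ℝ)
    (hδ : 0 ≤ δ) (d d' : ℕ) (hd : 1 ≤ d) (hd' : 1 ≤ d') :
    SignUncertainty.signConstant μ δ d = SignUncertainty.signConstant μ δ d' := by
  have : NeZero d := ⟨by lia⟩
  have : NeZero d' := ⟨by lia⟩
  exact le_antisymm (SignUncertainty.signConstant_le_signConstant hδ)
    (SignUncertainty.signConstant_le_signConstant hδ)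

theorem theorem1 (μ : MeasureTheory.Measure ℝ) [MeasureTheory.IsLocallyFiniteMeasure μ]
    [μ.IsNegInvariant] (δ : ℝ) (hδ : 0 ≤ δ) (d : ℕ) (hd : 1 ≤ d) :
    SignUncertainty.signConstant μ δ d = SignUncertainty.signConstant μ δ 1 :=
  theorem1_general μ δ hδ d 1 hd le_rfl
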